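/- Let $\mathcal C=\{0,1\}^{\mathbb N}$ be the binary Cantor set, and regard $\mathcal C\times\mathcal C$ as the unit square (binary expansions of the two coordinates). For finite binary words $u,v$ the dyadic rectangle $[u,v]$ is $u\mathcal C\times v\mathcal C$. The group $2V$ consists of all bijections $g$ of $\mathcal C\times\mathcal C$ for which there are two partitions of the square into finitely many dyadic rectangles and a bijection $[u_i,v_i]\mapsto[u_i',v_i']$ between their rectangles with $g(u_ix,v_iy)=(u_i'x,v_i'y)$ for all $x,y\in\mathcal C$ and all $i$. The vertical copy of $V$ in $2V$ consists of the elements for which both partitions can be chosen with vertical subdivisions only, i.e. with all $v_i,v_i'$ empty; the vertical copies of $T$ and of $F$ consist of those elements of the vertical copy of $V$ which preserve, respectively, the left-to-right cyclic order and the left-to-right (lexicographic) order of the first coordinates. Let $C_0\in 2V$ be $(bx,y)\mapsto(x,by)$ for $b\in\{0,1\}$, and let $X_0$ be the element of the vertical copy of $F$ which acts on the first coordinate by $0t\mapsto 00t$, $10t\mapsto 01t$, $11t\mapsto 1t$. Put $w_n=C_0^{-n}X_0C_0^n$ for $n\ge 0$, where products are compositions and the right factor acts first. For a subset $S$ of a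 group let $|g|_S$ be the least length of a word in $S\cup S^{-1}$ representing $g$ ($\infty$ if there is none). **Theorem 5.1 (distortion).** 1. The vertical copies of $F$, $T$ and $V$ are at least exponentially distorted in $2V$: if $H$ is any of these three subgroups, $S$ is any finite generating set of $2V$ and $A$ is any finite generating set of $H$, then there is $a>1$ such that for all sufficiently large $n$ $$\sup\{|h|_A : h\in H,\ |h|_S\le n\}\ \ge\ a^n .$$ 2. For every $n\ge 0$: $|w_n|_S\le 2n+1$ for every subset $S$ of $2V$ (in particular for every generating set) that contains $C_0$ and $X_0$; moreover $w_n$ lies in the vertical copy of $F$, and the number $N(w_n)$ of carets in each tree of a minimal tree-pair diagram of $w_n$ as an element of $F$ (two finite rooted binary trees with only vertical carets and equally many leaves, such that $w_n$ maps the strip over the $i$-th leaf of the first tree affinely onto the strip over the $i$-th leaf of the second, for every $i$) satisfies $2^n\le N(w_n)\le 3\cdot 2^n$. 3. The length of $w_n$ in the vertical subgroups is exponential: for every finite subset $A$ of the vertical copy of $V$ (in particular, for every finite generating set of the vertical copy of $F$, $T$ or $V$) there is $c>0$ such that $|w_n|_A\ge c\,2^n$ for all $n\ge 0$. -/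

import Mathlib

open Filter
open scoped ENNReal

/-! ### Dyadic subdivisions of the square

The square is the product of two binary Cantor sets: a point is a pair of infinite binary
expansions. A dyadic rectangle is a pair of finite binary words, the first one naming a dyadic
interval on the horizontal axis and the second one a dyadic interval on the vertical axis. -/

/-- The square, as pairs of infinite binary sequences. -/
abbrev Square : Type := Stream' Bool × Stream' Bool

/-- A dyadic rectangle, given by the binary words of its two sides. -/
abbrev Rect : Type := List Bool × List Bool

/-- The canonical affine parametrization of a dyadic rectangle by the whole square. -/
def Rect.embed (r : Rect) (z : Square) : Square :=
  (Stream'.appendStream' r.1 z.1, Stream'.appendStream' r.2 z.2)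

/-- The set of points of a dyadic rectangle. -/
def Rect.region (r : Rect) : Set Square := Set.range r.embed

/-- A dyadic subdivision: finitely many dyadic rectangles which partition the square. -/
def IsSubdivision (D : Finset Rect) : Prop :=
  ∀ x : Square, ∃! r : Rect, r ∈ D ∧ x ∈ r.region

/-- A subdivision that uses vertical subdivisions only, i.e. a partition into dyadic
strips `I × [0,1]`. -/
def IsVertical (D : Finset Rect) : Prop := ∀ r ∈ D, r.2 = []

/-- The bijection `g` maps the rectangles of the subdivision `D` affinely onto those of the
subdivision `R`, according to some bijection `σ` between the rectangles. -/
def IsRepresentedBy (D R : Finset Rect) (g : Equiv.Perm Square) : Prop :=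
  IsSubdivision D ∧ IsSubdivision R ∧
    ∃ σ : D ≃ R, ∀ (r : D) (z : Square), g (r.1.embed z) = (σ r).1.embed z

lemma embed_injective (r : Rect) : Function.Injective r.embed := by
  intro z w h
  have h1 := congrArg Prod.fst h
  have h2 := congrArg Prod.snd h
  exact Prod.ext (Stream'.append_right_injective _ _ _ h1)
    (Stream'.append_right_injective _ _ _ h2)

lemma embed_embed (r s : Rect) (z : Square) :
    r.embed (s.embed z) = Rect.embed (r.1 ++ s.1, r.2 ++ s.2) z := by
  simp [Rect.embed, Stream'.append_append_stream]

/-- The `2^N × 2^M` grid. -/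
def grid (N M : ℕ) : Finset Rect :=
  (Finset.univ.image (List.ofFn : (Fin N → Bool) → List Bool)) ×ˢ
    (Finset.univ.image (List.ofFn : (Fin M → Bool) → List Bool))

lemma mem_words (N : ℕ) (l : List Bool) :
    l ∈ Finset.univ.image (List.ofFn : (Fin N → Bool) → List Bool) ↔ l.length = N := by
  constructor
  · intro h
    obtain ⟨f, -, rfl⟩ := Finset.mem_image.1 h
    simp
  · rintro rfl
    exact Finset.mem_image.2 ⟨l.get, Finset.mem_univ _, List.ofFn_get l⟩

lemma mem_grid (N M : ℕ) (r : Rect) : r ∈ grid N M ↔ r.1.length = N ∧ r.2.length = M := by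
  rw [grid, Finset.mem_product, mem_words, mem_words]

lemma embed_take_drop (N M : ℕ) (x : Square) :
    Rect.embed (x.1.take N, x.2.take M) (x.1.drop N, x.2.drop M) = x := by
  simp [Rect.embed, Stream'.append_take_drop]

lemma grid_unique {N M : ℕ} {r s : Rect} (hr : r ∈ grid N M) (hs : s ∈ grid N M) {z w : Square}
    (h : r.embed z = s.embed w) : r = s := by
  rw [mem_grid] at hr hs
  exact Prod.ext
    (Stream'.append_left_injective _ _ _ _ (congrArg Prod.fst h) (hr.1.trans hs.1.symm))
    (Stream'.append_left_injective _ _ _ _ (congrArg Prod.snd h) (hr.2.trans hs.2.symm))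

lemma isSubdivision_grid (N M : ℕ) : IsSubdivision (grid N M) := by
  intro x
  refine ⟨(x.1.take N, x.2.take M), ⟨(mem_grid _ _ _).2 ⟨by simp, by simp⟩,
    ⟨_, embed_take_drop N M x⟩⟩, ?_⟩
  rintro s ⟨hs, w, hw⟩
  exact grid_unique hs ((mem_grid _ _ _).2 ⟨by simp, by simp⟩)
    (hw.trans (embed_take_drop N M x).symm)

/-- A bijection that is affine on every rectangle of a grid is represented by the grid and
its image. -/
lemma isRepresentedBy_of_grid {N M : ℕ} {g : Equiv.Perm Square} {Q : Rect → Prop}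
    (h : ∀ r ∈ grid N M, ∃ v, Q v ∧ ∀ z, g (r.embed z) = v.embed z) :
    ∃ R, (∀ v ∈ R, Q v) ∧ IsRepresentedBy (grid N M) R g := by
  choose v hQ hv using h
  let f : grid N M → Rect := fun r => v r.1 r.2
  have hf : Function.Injective f := by
    intro r s hrs
    have z : Square := (Stream'.const true, Stream'.const true)
    have : r.1.embed z = s.1.embed z := by
      apply g.injective
      rw [hv r.1 r.2, hv s.1 s.2]
      exact congrArg (fun u => Rect.embed u z) hrs
    exact Subtype.ext (grid_unique r.2 s.2 this)
  have hmem : ∀ r, f r ∈ Finset.univ.image f :=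
    fun r => Finset.mem_image_of_mem f (Finset.mem_univ r)
  refine ⟨Finset.univ.image f, ?_, isSubdivision_grid N M, ?_, ?_⟩
  · intro u hu
    obtain ⟨r, -, rfl⟩ := Finset.mem_image.1 hu
    exact hQ _ _
  · intro x
    obtain ⟨r, ⟨hr, z, hz⟩, huniq⟩ := isSubdivision_grid N M (g.symm x)
    refine ⟨f ⟨r, hr⟩, ⟨hmem _, z, ?_⟩, ?_⟩
    · change (v r hr).embed z = x
      rw [← hv, hz, g.apply_symm_apply]
    · rintro u ⟨hu, w, hw⟩
      obtain ⟨s, -, rfl⟩ := Finset.mem_image.1 hu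
      have : s.1 = r := by
        apply huniq
        refine ⟨s.2, w, ?_⟩
        rw [← hw, Equiv.eq_symm_apply]
        exact hv _ _ _
      exact congrArg f (Subtype.ext this)
  · refine ⟨Equiv.ofBijective (fun r => ⟨f r, hmem r⟩) ⟨?_, ?_⟩, ?_⟩
    · intro r s hrs
      exact hf (congrArg Subtype.val hrs)
    · rintro ⟨u, hu⟩
      obtain ⟨r, -, rfl⟩ := Finset.mem_image.1 hu
      exact ⟨r, rfl⟩
    · intro r z
      exact hv _ _ _

lemma prefix_of_append_eq {l a : List Bool} {s t : Stream' Bool}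
    (h : Stream'.appendStream' l s = Stream'.appendStream' a t) (hl : l.length ≤ a.length) :
    ∃ a', a = l ++ a' := by
  have h1 : l = a.take l.length := by
    have := congrArg (Stream'.take l.length) h
    rwa [Stream'.take_append_of_le_length _ _ _ le_rfl,
      Stream'.take_append_of_le_length _ _ _ hl, List.take_length] at this
  exact ⟨a.drop l.length, by
    conv_rhs => lhs; rw [h1]
    exact (List.take_append_drop _ _).symm⟩

lemma affine_on_grid {D R : Finset Rect} {g : Equiv.Perm Square} (h : IsRepresentedBy D R g)
    {N M : ℕ} (hN : ∀ r ∈ D, r.1.length ≤ N) (hM : ∀ r ∈ D, r.2.length ≤ M)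
    {r : Rect} (hr : N ≤ r.1.length ∧ M ≤ r.2.length) :
    ∃ s ∈ R, ∃ t : Rect, t.2.length ≤ r.2.length ∧
      ∀ z, g (r.embed z) = Rect.embed (s.1 ++ t.1, s.2 ++ t.2) z := by
  obtain ⟨hD, -, σ, hσ⟩ := h
  have z : Square := (Stream'.const true, Stream'.const true)
  obtain ⟨u, ⟨hu, w, hw⟩, -⟩ := hD (r.embed z)
  obtain ⟨a', ha⟩ := prefix_of_append_eq (congrArg Prod.fst hw) ((hN u hu).trans hr.1)
  obtain ⟨b', hb⟩ := prefix_of_append_eq (congrArg Prod.snd hw) ((hM u hu).trans hr.2)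
  refine ⟨(σ ⟨u, hu⟩).1, (σ ⟨u, hu⟩).2, (a', b'), by simp [hb], fun z => ?_⟩
  rw [← embed_embed, ← hσ, embed_embed]
  congr 2
  exact Prod.ext ha hb

lemma exists_depth (D : Finset Rect) :
    ∃ N, (∀ r ∈ D, r.1.length ≤ N) ∧ (∀ r ∈ D, r.2.length ≤ N) :=
  ⟨D.sup (fun r => max r.1.length r.2.length),
    fun _ hr => (le_max_left _ _).trans
      (Finset.le_sup (f := fun r : Rect => max r.1.length r.2.length) hr),
    fun _ hr => (le_max_right _ _).trans
      (Finset.le_sup (f := fun r : Rect => max r.1.length r.2.length) hr)⟩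

lemma isRepresentedBy_inv {D R : Finset Rect} {g : Equiv.Perm Square}
    (h : IsRepresentedBy D R g) : IsRepresentedBy R D g⁻¹ := by
  obtain ⟨hD, hR, σ, hσ⟩ := h
  refine ⟨hR, hD, σ.symm, fun r z => ?_⟩
  rw [Equiv.Perm.inv_eq_iff_eq, hσ, Equiv.apply_symm_apply]

lemma exists_split {N M : ℕ} {l : List Bool} (h : N + M ≤ l.length) :
    ∃ a b, l = a ++ b ∧ a.length = N ∧ M ≤ b.length :=
  ⟨l.take N, l.drop N, (List.take_append_drop N l).symm, by simp; omega, by simp; omega⟩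

lemma exists_mul {g h : Equiv.Perm Square}
    (hg : ∃ D R, IsRepresentedBy D R g) (hh : ∃ D R, IsRepresentedBy D R h) :
    ∃ D R, IsRepresentedBy D R (g * h) := by
  obtain ⟨D, R, hD⟩ := hg
  obtain ⟨D', R', hD'⟩ := hh
  obtain ⟨N, hN1, hN2⟩ := exists_depth D
  obtain ⟨M, hM1, hM2⟩ := exists_depth D'
  obtain ⟨R'', -, hR⟩ := isRepresentedBy_of_grid (N := M + N) (M := M + N) (g := g * h)
    (Q := fun _ => True) (by
      intro r hr
      rw [mem_grid] at hr
      obtain ⟨a, a', ha, ha1, ha2⟩ := exists_split hr.1.ge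
      obtain ⟨b, b', hb, hb1, hb2⟩ := exists_split hr.2.ge
      obtain ⟨s, -, t, -, hst⟩ := affine_on_grid hD' hM1 hM2 (r := (a, b)) ⟨ha1.ge, hb1.ge⟩
      obtain ⟨s', -, t', -, hst'⟩ := affine_on_grid hD hN1 hN2
        (r := (s.1 ++ t.1 ++ a', s.2 ++ t.2 ++ b')) ⟨by simp; omega, by simp; omega⟩
      refine ⟨(s'.1 ++ t'.1, s'.2 ++ t'.2), trivial, fun z => ?_⟩
      rw [← hst', Equiv.Perm.mul_apply]
      congr 1
      have : r.embed z = Rect.embed (a, b) (Rect.embed (a', b') z) := by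
        rw [embed_embed]
        congr 2
        exact Prod.ext ha hb
      rw [this, hst, embed_embed])
  exact ⟨_, _, hR⟩

lemma exists_vertical_mul {g h : Equiv.Perm Square}
    (hg : ∃ D R, IsVertical D ∧ IsVertical R ∧ IsRepresentedBy D R g)
    (hh : ∃ D R, IsVertical D ∧ IsVertical R ∧ IsRepresentedBy D R h) :
    ∃ D R, IsVertical D ∧ IsVertical R ∧ IsRepresentedBy D R (g * h) := by
  obtain ⟨D, R, hv, hv2, hD⟩ := hg
  obtain ⟨D', R', hv', hv2', hD'⟩ := hh
  obtain ⟨N, hN1, -⟩ := exists_depth D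
  obtain ⟨M, hM1, -⟩ := exists_depth D'
  obtain ⟨R'', hQ, hR⟩ := isRepresentedBy_of_grid (N := M + N) (M := 0) (g := g * h)
    (Q := fun v => v.2 = []) (by
      intro r hr
      rw [mem_grid] at hr
      obtain ⟨a, a', ha, ha1, ha2⟩ := exists_split hr.1.ge
      have hb : r.2 = [] := List.length_eq_zero_iff.1 hr.2
      obtain ⟨s, hs, t, ht, hst⟩ := affine_on_grid hD' (M := 0) hM1
        (fun r hr => by simp [hv' r hr]) (r := (a, [])) ⟨ha1.ge, le_rfl⟩
      have ht0 : t.2 = [] := List.length_eq_zero_iff.1 (Nat.le_zero.1 ht)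
      have hs0 : s.2 = [] := hv2' s hs
      obtain ⟨s', hs', t', ht', hst'⟩ := affine_on_grid hD (M := 0) hN1
        (fun r hr => by simp [hv r hr])
        (r := (s.1 ++ t.1 ++ a', [])) ⟨by simp; omega, le_rfl⟩
      have ht0' : t'.2 = [] := List.length_eq_zero_iff.1 (Nat.le_zero.1 ht')
      refine ⟨(s'.1 ++ t'.1, s'.2 ++ t'.2), by simp [ht0', hv2 s' hs'], fun z => ?_⟩
      rw [← hst', Equiv.Perm.mul_apply]
      congr 1
      have : r.embed z = Rect.embed (a, []) (Rect.embed (a', []) z) := by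
        rw [embed_embed]
        congr 2
        exact Prod.ext ha hb
      rw [this, hst, embed_embed, ht0, hs0]
      rfl)
  refine ⟨_, _, fun r hr => ?_, hQ, hR⟩
  exact List.length_eq_zero_iff.1 ((mem_grid _ _ _).1 hr).2

lemma isRepresentedBy_one : IsRepresentedBy (grid 0 0) (grid 0 0) 1 :=
  ⟨isSubdivision_grid 0 0, isSubdivision_grid 0 0, Equiv.refl _, fun _ _ => rfl⟩

lemma isVertical_grid (N : ℕ) : IsVertical (grid N 0) :=
  fun _ hr => List.length_eq_zero_iff.1 ((mem_grid _ _ _).1 hr).2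

/-! ### The groups -/

/-- The group `2V`: bijections of the square given by two dyadic subdivisions and a bijection
between their rectangles. -/
def twoV : Subgroup (Equiv.Perm Square) where
  carrier := {g | ∃ D R : Finset Rect, IsRepresentedBy D R g}
  mul_mem' := exists_mul
  one_mem' := ⟨_, _, isRepresentedBy_one⟩
  inv_mem' := by
    rintro g ⟨D, R, h⟩
    exact ⟨R, D, isRepresentedBy_inv h⟩

/-- The vertical copy of `V` in `2V`: the elements which can be given using vertical
subdivisions only. -/
def verticalV : Subgroup twoV where
  carrier := {g | ∃ D R : Finset Rect, IsVertical D ∧ IsVertical R ∧ IsRepresentedBy D R g.1}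
  mul_mem' := exists_vertical_mul
  one_mem' := ⟨_, _, isVertical_grid 0, isVertical_grid 0, isRepresentedBy_one⟩
  inv_mem' := by
    rintro g ⟨D, R, hD, hR, h⟩
    exact ⟨R, D, hR, hD, isRepresentedBy_inv h⟩

/-- The order of the Cantor set (the lexicographic order of binary expansions). -/
def LexLT (x y : Stream' Bool) : Prop :=
  ∃ n, (∀ k < n, x.get k = y.get k) ∧ x.get n = false ∧ y.get n = true

/-- The cyclic order of the Cantor set: `x, y, z` occur in this order when moving to the right
around the circle. -/
def CyclicLT (x y z : Stream' Bool) : Prop :=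
  (LexLT x y ∧ LexLT y z) ∨ (LexLT y z ∧ LexLT z x) ∨ (LexLT z x ∧ LexLT x y)

/-- The vertical copy of `F` in `2V`: the elements of the vertical copy of `V` which preserve
the left-to-right order. -/
def verticalF : Subgroup twoV where
  carrier := {g | g ∈ verticalV ∧
    ∀ p q : Square, LexLT (g.1 p).1 (g.1 q).1 ↔ LexLT p.1 q.1}
  mul_mem' := by
    rintro g h ⟨hg, hg'⟩ ⟨hh, hh'⟩
    exact ⟨mul_mem hg hh, fun p q => (hg' _ _).trans (hh' p q)⟩
  one_mem' := ⟨one_mem _, fun _ _ => Iff.rfl⟩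
  inv_mem' := by
    rintro g ⟨hg, hg'⟩
    refine ⟨inv_mem hg, fun p q => ?_⟩
    rw [← hg']
    change LexLT (g.1 (g.1.symm p)).1 (g.1 (g.1.symm q)).1 ↔ _
    rw [Equiv.apply_symm_apply, Equiv.apply_symm_apply]

/-- The vertical copy of `T` in `2V`: the elements of the vertical copy of `V` which preserve
the left-to-right cyclic order. -/
def verticalT : Subgroup twoV where
  carrier := {g | g ∈ verticalV ∧
    ∀ p q r : Square, CyclicLT (g.1 p).1 (g.1 q).1 (g.1 r).1 ↔ CyclicLT p.1 q.1 r.1}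
  mul_mem' := by
    rintro g h ⟨hg, hg'⟩ ⟨hh, hh'⟩
    exact ⟨mul_mem hg hh, fun p q r => (hg' _ _ _).trans (hh' p q r)⟩
  one_mem' := ⟨one_mem _, fun _ _ _ => Iff.rfl⟩
  inv_mem' := by
    rintro g ⟨hg, hg'⟩
    refine ⟨inv_mem hg, fun p q r => ?_⟩
    rw [← hg']
    change CyclicLT (g.1 (g.1.symm p)).1 (g.1 (g.1.symm q)).1 (g.1 (g.1.symm r)).1 ↔ _
    rw [Equiv.apply_symm_apply, Equiv.apply_symm_apply, Equiv.apply_symm_apply]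

/-! ### The witness -/

/-- The underlying bijection of `C₀`: the left half of the square is mapped affinely onto the
bottom half, the right half onto the top half. -/
def c0Perm : Equiv.Perm Square where
  toFun p := (p.1.tail, Stream'.cons p.1.head p.2)
  invFun p := (Stream'.cons p.2.head p.1, p.2.tail)
  left_inv p := Prod.ext (Stream'.eta p.1) rfl
  right_inv p := Prod.ext rfl (Stream'.eta p.2)

/-- The standard first generator of `F` acting on one coordinate:
`0t ↦ 00t`, `10t ↦ 01t`, `11t ↦ 1t`. -/
def x0Fun (s : Stream' Bool) : Stream' Bool :=
  if s.head = false then Stream'.cons false (Stream'.cons false s.tail)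
  else if s.tail.head = false then Stream'.cons false (Stream'.cons true s.tail.tail)
  else Stream'.cons true s.tail.tail

/-- The inverse of `x0Fun`. -/
def x0Inv (s : Stream' Bool) : Stream' Bool :=
  if s.head = true then Stream'.cons true (Stream'.cons true s.tail)
  else if s.tail.head = false then Stream'.cons false s.tail.tail
  else Stream'.cons true (Stream'.cons false s.tail.tail)

lemma x0Inv_x0Fun (s : Stream' Bool) : x0Inv (x0Fun s) = s := by
  obtain ⟨a, s, rfl⟩ : ∃ a t, s = Stream'.cons a t := ⟨s.head, s.tail, (Stream'.eta s).symm⟩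
  obtain ⟨b, s, rfl⟩ : ∃ b t, s = Stream'.cons b t := ⟨s.head, s.tail, (Stream'.eta s).symm⟩
  cases a <;> cases b <;> simp [x0Inv, x0Fun]

lemma x0Fun_x0Inv (s : Stream' Bool) : x0Fun (x0Inv s) = s := by
  obtain ⟨a, s, rfl⟩ : ∃ a t, s = Stream'.cons a t := ⟨s.head, s.tail, (Stream'.eta s).symm⟩
  obtain ⟨b, s, rfl⟩ : ∃ b t, s = Stream'.cons b t := ⟨s.head, s.tail, (Stream'.eta s).symm⟩
  cases a <;> cases b <;> simp [x0Inv, x0Fun]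

/-- The underlying bijection of `X₀`. -/
def x0Perm : Equiv.Perm Square where
  toFun p := (x0Fun p.1, p.2)
  invFun p := (x0Inv p.1, p.2)
  left_inv p := Prod.ext (x0Inv_x0Fun p.1) rfl
  right_inv p := Prod.ext (x0Fun_x0Inv p.1) rfl

lemma c0Perm_mem : c0Perm ∈ twoV := by
  obtain ⟨R, -, hR⟩ := isRepresentedBy_of_grid (N := 1) (M := 0) (g := c0Perm)
    (Q := fun _ => True) (by
      rintro ⟨a, b⟩ hr
      obtain ⟨ha, hb⟩ := (mem_grid _ _ _).1 hr
      obtain ⟨i, rfl⟩ := List.length_eq_one_iff.1 ha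
      obtain rfl := List.length_eq_zero_iff.1 hb
      exact ⟨([], [i]), trivial, fun z => rfl⟩)
  exact ⟨_, _, hR⟩

lemma x0Perm_mem : x0Perm ∈ twoV := by
  obtain ⟨R, -, hR⟩ := isRepresentedBy_of_grid (N := 2) (M := 0) (g := x0Perm)
    (Q := fun _ => True) (by
      rintro ⟨a, b⟩ hr
      obtain ⟨ha, hb⟩ := (mem_grid _ _ _).1 hr
      obtain ⟨i, j, rfl⟩ := List.length_eq_two.1 ha
      obtain rfl := List.length_eq_zero_iff.1 hb
      cases i
      · exact ⟨([false, false, j], []), trivial, fun z => rfl⟩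
      · cases j
        · exact ⟨([false, true], []), trivial, fun z => rfl⟩
        · exact ⟨([true], []), trivial, fun z => rfl⟩)
  exact ⟨_, _, hR⟩

/-- The generator `C₀` of `2V`. -/
def genC0 : twoV := ⟨c0Perm, c0Perm_mem⟩

/-- The generator `X₀` of `F`, in the vertical copy of `F` in `2V`. -/
def genX0 : twoV := ⟨x0Perm, x0Perm_mem⟩

/-- The witness `C₀⁻ⁿ X₀ C₀ⁿ` (products are compositions, the right factor acting first). -/
def witness (n : ℕ) : twoV := (genC0 ^ n)⁻¹ * genX0 * genC0 ^ n

/-! ### Carets -/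

/-- The leaves of a finite rooted binary tree, from left to right, as dyadic intervals. -/
def treeLeaves : BinaryTree Unit → List (List Bool)
  | .nil => [[]]
  | .node _ l r => (treeLeaves l).map (List.cons false) ++ (treeLeaves r).map (List.cons true)

/-- `(T₊, id, T₋)` is a tree-pair diagram for `g` all of whose carets are vertical: the trees
have the same number of carets, and `g` maps the strip over the `i`-th leaf of the first tree
affinely onto the strip over the `i`-th leaf of the second one. -/
def IsTreePairF (D R : BinaryTree Unit) (g : twoV) : Prop :=
  D.numNodes = R.numNodes ∧ ∀ p ∈ (treeLeaves D).zip (treeLeaves R), ∀ z : Square,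
    g.1 (Rect.embed (p.1, []) z) = Rect.embed (p.2, []) z

/-- The number of carets (in each tree) of a minimal vertical tree-pair diagram of an element of
the vertical copy of `F`; it is `⊤` if there is no such diagram. -/
noncomputable def caretNumberF (g : twoV) : ℕ∞ :=
  ⨅ (D : BinaryTree Unit) (R : BinaryTree Unit) (_ : IsTreePairF D R g), (D.numNodes : ℕ∞)

/-! ### Word length and distortion -/

/-- The word length of `g` with respect to a set `S`: the least length of a word in the elements
of `S` and their inverses with value `g`, and `⊤` if there is no such word. -/
noncomputable def wordLength {G : Type*} [Group G] (S : Set G) (g : G) : ℕ∞ :=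
  ⨅ (l : List G) (_ : (∀ x ∈ l, x ∈ S ∨ x⁻¹ ∈ S) ∧ l.prod = g), (l.length : ℕ∞)

/-- The distortion function of `H` in `G` for generating sets `S` of `G` and `A` of `H`: the
largest `A`-length of an element of `H` whose `S`-length is at most `n`. -/
noncomputable def distortion {G : Type*} [Group G] (H : Subgroup G) (S A : Set G) (n : ℕ) : ℕ∞ :=
  ⨆ (h : G) (_ : h ∈ H ∧ wordLength S h ≤ n), wordLength A h

/-- `H` is at least exponentially distorted in `G`: with respect to any finite generating sets,
the distortion function grows at least exponentially. -/
def IsAtLeastExponentiallyDistorted {G : Type*} [Group G] (H : Subgroup G) : Prop :=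
  ∀ S A : Set G, S.Finite → A.Finite → Subgroup.closure S = ⊤ → Subgroup.closure A = H →
    ∃ a : ℝ, 1 < a ∧ ∀ᶠ n : ℕ in atTop,
      ENNReal.ofReal (a ^ n) ≤ ((distortion H S A n : ℕ∞) : ℝ≥0∞)

/-! For a map `f` of the square, call a word `u` *broken* if `f` does not map the strip over `u`
affinely onto a strip. The number `B` of broken words is subadditive under composition and finite
exactly on the vertical copy of `V`, so it is a lower bound, up to a constant factor, for the word
length with respect to any finite subset of that copy. It also bounds the number of carets from
below, since every broken word is an inner vertex of the first tree of any tree-pair diagram.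

Conjugating by `C₀` hides the first digit of `x` while `X₀` acts, so `w_{n+1}` acts like `w_n` on
each of the two vertical halves of the square. Thus `B (w_{n+1}) = 2 * B (w_n) + 1`, and
`B (w_n) = 3 * 2 ^ n - 1` grows exponentially, although `w_n` has linear length in `2V`. -/

/-! ### Word length -/

section WordLength

variable {G : Type*} [Group G] {S : Set G}

lemma wordLength_le_length {l : List G} (hl : ∀ x ∈ l, x ∈ S ∨ x⁻¹ ∈ S) :
    wordLength S l.prod ≤ l.length :=
  iInf₂_le l ⟨hl, rfl⟩

lemma wordLength_one : wordLength S (1 : G) = 0 :=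
  nonpos_iff_eq_zero.1 (wordLength_le_length (l := []) (by simp))

lemma wordLength_le_one {g : G} (hg : g ∈ S) : wordLength S g ≤ 1 := by
  simpa using wordLength_le_length (l := [g]) (by simp [hg])

lemma exists_list_length_eq_wordLength {g : G} (hg : wordLength S g ≠ ⊤) :
    ∃ l : List G, (∀ x ∈ l, x ∈ S ∨ x⁻¹ ∈ S) ∧ l.prod = g ∧ (l.length : ℕ∞) = wordLength S g := by
  by_contra! hne
  have hlt : ∀ l : List G, (∀ x ∈ l, x ∈ S ∨ x⁻¹ ∈ S) ∧ l.prod = g → wordLength S g < l.length :=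
    fun l ⟨hl, hprod⟩ => (hprod ▸ wordLength_le_length hl).lt_of_ne (hne l hl hprod).symm
  exact lt_irrefl _ ((ENat.add_one_le_iff hg).1
    (le_iInf₂ fun l hl => (ENat.add_one_le_iff hg).2 (hlt l hl)))

lemma wordLength_mul_le (g h : G) : wordLength S (g * h) ≤ wordLength S g + wordLength S h := by
  by_cases hg : wordLength S g = ⊤
  · simp [hg]
  by_cases hh : wordLength S h = ⊤
  · simp [hh]
  obtain ⟨l, hl, rfl, hlen⟩ := exists_list_length_eq_wordLength hg
  obtain ⟨k, hk, rfl, hklen⟩ := exists_list_length_eq_wordLength hh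
  rw [← hlen, ← hklen, ← List.prod_append, ← Nat.cast_add, ← List.length_append]
  exact wordLength_le_length fun x hx => (List.mem_append.1 hx).elim (hl x) (hk x)

lemma wordLength_inv_le (g : G) : wordLength S g⁻¹ ≤ wordLength S g := by
  refine le_iInf₂ fun l ⟨hl, hprod⟩ => ?_
  rw [← hprod, List.prod_inv_reverse, ← List.length_map (f := (·⁻¹)), ← List.length_reverse]
  refine wordLength_le_length fun x hx => ?_
  obtain ⟨y, hy, rfl⟩ := List.mem_map.1 (List.mem_reverse.1 hx)
  simpa only [inv_inv, or_comm] using hl y hy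

lemma wordLength_pow_le (g : G) (n : ℕ) : wordLength S (g ^ n) ≤ n * wordLength S g := by
  induction n with
  | zero => simp [wordLength_one]
  | succ n ih =>
    rw [pow_succ, Nat.cast_succ, add_mul, one_mul]
    exact (wordLength_mul_le _ _).trans (by gcongr)

lemma wordLength_conj_pow_le (c x : G) (n : ℕ) :
    wordLength S ((c ^ n)⁻¹ * x * c ^ n) ≤ 2 * n * wordLength S c + wordLength S x :=
  calc wordLength S ((c ^ n)⁻¹ * x * c ^ n)
      ≤ wordLength S (c ^ n)⁻¹ + wordLength S x + wordLength S (c ^ n) :=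
        (wordLength_mul_le _ _).trans (by gcongr; exact wordLength_mul_le _ _)
    _ ≤ n * wordLength S c + wordLength S x + n * wordLength S c := by
        gcongr
        · exact (wordLength_inv_le _).trans (wordLength_pow_le c n)
        · exact wordLength_pow_le c n
    _ = 2 * n * wordLength S c + wordLength S x := by ring

lemma wordLength_ne_top {g : G} (hg : g ∈ Subgroup.closure S) : wordLength S g ≠ ⊤ := by
  rw [← Subgroup.mem_toSubmonoid, Subgroup.closure_toSubmonoid] at hg
  obtain ⟨l, hl, rfl⟩ := Submonoid.exists_list_of_mem_closure hg
  exact ne_top_of_le_ne_top (ENat.natCast_ne_top _) (wordLength_le_length hl)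

lemma le_wordLength_mul_of_subadditive {f : G → ℕ∞} (f_one : f 1 = 0)
    (f_mul : ∀ g h, f (g * h) ≤ f g + f h) {C : ℕ∞} (hC : C ≠ 0)
    (f_le : ∀ x, x ∈ S ∨ x⁻¹ ∈ S → f x ≤ C) (g : G) : f g ≤ wordLength S g * C := by
  by_cases hg : wordLength S g = ⊤
  · simp [hg, ENat.top_mul hC]
  obtain ⟨l, hl, rfl, hlen⟩ := exists_list_length_eq_wordLength hg
  rw [← hlen]
  clear hg hlen
  induction l with
  | nil => simp [f_one]
  | cons x l ih =>
    rw [List.forall_mem_cons] at hl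
    calc f (x :: l).prod ≤ f x + f l.prod := f_mul x l.prod
      _ ≤ C + l.length * C := add_le_add (f_le x hl.1) (ih hl.2)
      _ = (x :: l).length * C := by push_cast [List.length_cons]; ring

end WordLength

/-! ### Exponential distortion -/

lemma exists_eventually_pow_le_mul_pow_div {b c : ℝ} (hb : 1 < b) (hc : 0 < c) {K : ℕ}
    (hK : K ≠ 0) : ∃ a : ℝ, 1 < a ∧ ∀ᶠ n : ℕ in atTop, a ^ n ≤ c * b ^ (n / K) := by
  have hsqrt : 1 < √b := Real.lt_sqrt_of_sq_lt (by simpa using hb)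
  have ha : 1 < √b ^ (K : ℝ)⁻¹ := Real.one_lt_rpow hsqrt (by positivity)
  refine ⟨√b ^ (K : ℝ)⁻¹, ha, ?_⟩
  have hlim : Tendsto (fun n : ℕ => √b ^ (n / K)) atTop atTop :=
    (tendsto_pow_atTop_atTop_of_one_lt hsqrt).comp (Nat.tendsto_div_const_atTop hK)
  filter_upwards [hlim.eventually_ge_atTop (√b / c)] with n hn
  calc (√b ^ (K : ℝ)⁻¹) ^ n ≤ (√b ^ (K : ℝ)⁻¹) ^ (K * (n / K + 1)) :=
        pow_le_pow_right₀ ha.le (Nat.lt_mul_div_succ n hK.bot_lt).le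
    _ = √b * √b ^ (n / K) := by
        rw [pow_mul, Real.rpow_inv_natCast_pow (by positivity) hK, pow_succ']
    _ ≤ c * √b ^ (n / K) * √b ^ (n / K) := by
        gcongr
        exact (div_le_iff₀' hc).1 hn
    _ = c * b ^ (n / K) := by rw [mul_assoc, ← mul_pow, Real.mul_self_sqrt (by positivity)]

lemma exists_eventually_pow_le_distortion {G : Type*} [Group G] {H : Subgroup G} {S A : Set G}
    {w : ℕ → G} (hH : ∀ n, w n ∈ H) {p q : ℕ} (hS : ∀ n, wordLength S (w n) ≤ (p * n + q : ℕ))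
    {b c : ℝ} (hb : 1 < b) (hc : 0 < c)
    (hA : ∀ n, ENNReal.ofReal (c * b ^ n) ≤ ((wordLength A (w n) : ℕ∞) : ℝ≥0∞)) :
    ∃ a : ℝ, 1 < a ∧ ∀ᶠ n : ℕ in atTop,
      ENNReal.ofReal (a ^ n) ≤ ((distortion H S A n : ℕ∞) : ℝ≥0∞) := by
  let K := p + q + 1
  obtain ⟨a, ha, hpow⟩ := exists_eventually_pow_le_mul_pow_div hb hc (K := K) (by omega)
  refine ⟨a, ha, ?_⟩
  filter_upwards [hpow, eventually_ge_atTop K] with n hn hKn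
  have hlen : p * (n / K) + q ≤ n := by
    have hpos : 1 ≤ n / K := (Nat.one_le_div_iff (by omega)).2 hKn
    calc p * (n / K) + q ≤ p * (n / K) + q * (n / K) + n / K := by
          linarith [Nat.le_mul_of_pos_right q hpos]
      _ = K * (n / K) := by simp only [K]; ring
      _ ≤ n := Nat.mul_div_le n K
  have hword : wordLength S (w (n / K)) ≤ n := (hS _).trans (by exact_mod_cast hlen)
  calc ENNReal.ofReal (a ^ n) ≤ ENNReal.ofReal (c * b ^ (n / K)) := ENNReal.ofReal_le_ofReal hn
    _ ≤ ((wordLength A (w (n / K)) : ℕ∞) : ℝ≥0∞) := hA _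
    _ ≤ ((distortion H S A n : ℕ∞) : ℝ≥0∞) :=
        ENat.toENNReal_le.2 (le_iSup₂_of_le (w (n / K)) ⟨hH _, hword⟩ le_rfl)

/-! ### Broken words -/

/-- `f` maps the vertical strip over `u` affinely onto the vertical strip over `v`. -/
def MapsStrip (f : Square → Square) (u v : List Bool) : Prop :=
  ∀ z : Square, f (Rect.embed (u, []) z) = Rect.embed (v, []) z

/-- The words over which `f` does not map the vertical strip affinely onto another one. For an
element of the vertical copy of `F` these are the inner vertices of the first tree of its minimal
tree-pair diagram. -/
def brokenWords (f : Square → Square) : Set (List Bool) :=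
  {u | ¬∃ v, MapsStrip f u v}

lemma eq_nil_of_forall_eq_append {f : Stream' Bool → Stream' Bool}
    (hf : Function.Surjective fun x => (f x).head) {v : List Bool}
    (h : ∀ x, f x = Stream'.appendStream' v x) : v = [] := by
  rcases v with _ | ⟨b, v⟩
  · rfl
  · obtain ⟨x, hx⟩ := hf !b
    simp [h] at hx

lemma head_surjective : Function.Surjective (Stream'.head : Stream' Bool → Bool) :=
  fun b => ⟨Stream'.const b, rfl⟩

lemma append_left_cancel {u v : List Bool}
    (h : ∀ x : Stream' Bool, Stream'.appendStream' u x = Stream'.appendStream' v x) : u = v := by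
  wlog hle : u.length ≤ v.length generalizing u v
  · exact (this (fun x => (h x).symm) (le_of_not_ge hle)).symm
  obtain ⟨a, rfl⟩ := prefix_of_append_eq (h (Stream'.const true)) hle
  have ha : a = [] := eq_nil_of_forall_eq_append (f := id) head_surjective fun x =>
    Stream'.append_right_injective u _ _ (by rw [id, h, Stream'.append_append_stream])
  simp [ha]

lemma MapsStrip.comp {f g : Square → Square} {u v w : List Bool} (hf : MapsStrip f v w)
    (hg : MapsStrip g u v) : MapsStrip (f ∘ g) u w :=
  fun z => (congrArg f (hg z)).trans (hf z)

lemma MapsStrip.append {f : Square → Square} {u v : List Bool} (h : MapsStrip f u v)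
    (w : List Bool) : MapsStrip f (u ++ w) (v ++ w) := fun z => by
  simpa only [embed_embed, List.append_nil] using h (Rect.embed (w, []) z)

lemma MapsStrip.source_unique {f : Square → Square} (hf : Function.Injective f)
    {u v w : List Bool} (hu : MapsStrip f u w) (hv : MapsStrip f v w) : u = v :=
  append_left_cancel fun x => congrArg Prod.fst (hf ((hu (x, x)).trans (hv (x, x)).symm))

lemma brokenWords_id : brokenWords id = ∅ :=
  Set.eq_empty_of_forall_notMem fun u hu => hu ⟨u, fun _ => rfl⟩

lemma encard_brokenWords_comp_le (f : Square → Square) {g : Square → Square}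
    (hg : Function.Injective g) :
    (brokenWords (f ∘ g)).encard ≤ (brokenWords f).encard + (brokenWords g).encard := by
  let T : Set (List Bool) := {u | ∃ v ∈ brokenWords f, MapsStrip g u v}
  have hsub : brokenWords (f ∘ g) ⊆ T ∪ brokenWords g := by
    intro u hu
    by_cases hug : u ∈ brokenWords g
    · exact Or.inr hug
    · obtain ⟨v, hv⟩ := not_not.1 hug
      exact Or.inl ⟨v, fun ⟨w, hw⟩ => hu ⟨w, hw.comp hv⟩, hv⟩
  have hT : T.encard ≤ (brokenWords f).encard := by
    have htarget : ∀ u ∈ T, ∃ v, v ∈ brokenWords f ∧ MapsStrip g u v := fun _ hu => hu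
    choose! target hmem hmaps using htarget
    exact Set.encard_le_encard_of_injOn hmem fun u hu v hv huv =>
      (hmaps u hu).source_unique hg (huv ▸ hmaps v hv)
  calc (brokenWords (f ∘ g)).encard ≤ (T ∪ brokenWords g).encard := Set.encard_le_encard hsub
    _ ≤ T.encard + (brokenWords g).encard := Set.encard_union_le _ _
    _ ≤ (brokenWords f).encard + (brokenWords g).encard := by gcongr

lemma mem_verticalV_iff_finite_brokenWords (g : twoV) :
    g ∈ verticalV ↔ (brokenWords g.1).Finite := by
  constructor
  · rintro ⟨D, R, hD, hR, hg⟩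
    obtain ⟨N, hN, -⟩ := exists_depth D
    refine (List.finite_length_le Bool N).subset fun u hu => ?_
    by_contra hlen
    obtain ⟨s, hs, t, ht, hst⟩ := affine_on_grid hg (M := 0) hN (fun r hr => by simp [hD r hr])
      (r := (u, [])) ⟨(not_le.1 hlen).le, le_rfl⟩
    have ht_nil : t.2 = [] := List.length_eq_zero_iff.1 (Nat.le_zero.1 ht)
    exact hu ⟨s.1 ++ t.1, fun z => by rw [hst, hR s hs, ht_nil, List.append_nil]⟩
  · intro hfin
    obtain ⟨N, hN⟩ := (hfin.image List.length).bddAbove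
    have hgrid : ∀ r ∈ grid (N + 1) 0, ∃ v : Rect, v.2 = [] ∧
        ∀ z, g.1 (r.embed z) = v.embed z := by
      rintro ⟨u, t⟩ hr
      obtain ⟨hu : u.length = N + 1, ht⟩ := (mem_grid _ _ _).1 hr
      obtain rfl : t = [] := List.length_eq_zero_iff.1 ht
      have hunbroken : u ∉ brokenWords g.1 := fun hbroken => by
        have hle : u.length ≤ N := hN (Set.mem_image_of_mem _ hbroken)
        omega
      obtain ⟨v, hv⟩ := not_not.1 hunbroken
      exact ⟨(v, []), rfl, hv⟩
    obtain ⟨R, hR, hrep⟩ := isRepresentedBy_of_grid hgrid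
    exact ⟨_, R, isVertical_grid _, hR, hrep⟩

lemma exists_encard_brokenWords_le_wordLength_mul {A : Set twoV} (hA : A.Finite)
    (hAV : A ⊆ verticalV) :
    ∃ C : ℕ, C ≠ 0 ∧ ∀ g : twoV, (brokenWords g.1).encard ≤ wordLength A g * C := by
  obtain ⟨C, hC⟩ :=
    ((hA.union hA.inv).image fun g : twoV => (brokenWords g.1).ncard).bddAbove
  refine ⟨C + 1, C.succ_ne_zero, le_wordLength_mul_of_subadditive
    (by simpa using congrArg Set.encard brokenWords_id)
    (fun g h => encard_brokenWords_comp_le g.1 h.1.injective) (by simp) fun x hx => ?_⟩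
  have hxV : x ∈ verticalV := hx.elim (fun h => hAV h) fun h => inv_mem_iff.1 (hAV h)
  rw [← ((mem_verticalV_iff_finite_brokenWords x).1 hxV).cast_ncard_eq]
  exact_mod_cast (hC (Set.mem_image_of_mem _ hx)).trans C.le_succ

/-! ### Carets -/

lemma length_treeLeaves (t : BinaryTree Unit) : (treeLeaves t).length = t.numNodes + 1 := by
  induction t with
  | nil => rfl
  | node _ l r hl hr =>
    simp only [treeLeaves, List.length_append, List.length_map, hl, hr, BinaryTree.numNodes]
    omega

/-- The carets of a finite rooted binary tree, given by the addresses of their roots, which are the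
inner vertices of the tree. -/
def treeCarets : BinaryTree Unit → List (List Bool)
  | .nil => []
  | .node _ l r =>
    [] :: ((treeCarets l).map (List.cons false) ++ (treeCarets r).map (List.cons true))

lemma length_treeCarets (t : BinaryTree Unit) : (treeCarets t).length = t.numNodes := by
  induction t with
  | nil => rfl
  | node _ l r hl hr => simp [treeCarets, hl, hr, BinaryTree.numNodes]

lemma mem_treeCarets_or_exists_leaf_prefix (t : BinaryTree Unit) (u : List Bool) :
    u ∈ treeCarets t ∨ ∃ p ∈ treeLeaves t, p <+: u := by
  induction t generalizing u with
  | nil => exact Or.inr ⟨[], by simp [treeLeaves], u.nil_prefix⟩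
  | node _ l r hl hr =>
    rcases u with _ | ⟨_ | _, u⟩
    · simp [treeCarets]
    · simpa [treeCarets, treeLeaves, or_and_right, exists_or] using hl u
    · simpa [treeCarets, treeLeaves, or_and_right, exists_or] using hr u

lemma IsTreePairF.brokenWords_subset {D R : BinaryTree Unit} {g : twoV}
    (h : IsTreePairF D R g) : brokenWords g.1 ⊆ {u | u ∈ treeCarets D} := by
  intro u hu
  refine (mem_treeCarets_or_exists_leaf_prefix D u).resolve_right ?_
  rintro ⟨p, hp, w, rfl⟩
  have hlen : (treeLeaves D).length ≤ (treeLeaves R).length := by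
    rw [length_treeLeaves, length_treeLeaves, h.1]
  rw [← List.map_fst_zip hlen, List.mem_map] at hp
  obtain ⟨pq, hpq, rfl⟩ := hp
  exact hu ⟨_, MapsStrip.append (h.2 pq hpq) w⟩

lemma encard_brokenWords_le_caretNumberF (g : twoV) :
    (brokenWords g.1).encard ≤ caretNumberF g := by
  refine le_iInf fun D => le_iInf₂ fun R h => ?_
  calc (brokenWords g.1).encard ≤ ((treeCarets D).toFinset : Set (List Bool)).encard := by
        simpa using Set.encard_le_encard h.brokenWords_subset
    _ ≤ (treeCarets D).length := by
        rw [Set.encard_coe_eq_coe_finsetCard]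
        exact_mod_cast List.toFinset_card_le _
    _ = D.numNodes := by rw [length_treeCarets]

/-! ### Maps acting below the first digit -/

/-- The self-map of the Cantor set which keeps the first digit and applies `f` to the remaining
ones. -/
def onTail (f : Stream' Bool → Stream' Bool) (s : Stream' Bool) : Stream' Bool :=
  Stream'.cons s.head (f s.tail)

section OnTail

variable {f : Stream' Bool → Stream' Bool}

lemma onTail_ne_id (hf : f ≠ id) : onTail f ≠ id := fun h =>
  hf (funext fun x => congrArg Stream'.tail (congrFun h (Stream'.cons true x)))

lemma mapsStrip_prodMap_id {u v : List Bool} : MapsStrip (Prod.map f id) u v ↔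
    ∀ x, f (Stream'.appendStream' u x) = Stream'.appendStream' v x :=
  ⟨fun h x => congrArg Prod.fst (h (x, x)), fun h z => Prod.ext (h z.1) rfl⟩

lemma MapsStrip.onTail_cons {u v : List Bool} (h : MapsStrip (Prod.map f id) u v) (b : Bool) :
    MapsStrip (Prod.map (onTail f) id) (b :: u) (b :: v) :=
  mapsStrip_prodMap_id.2 fun x => congrArg (Stream'.cons b) (mapsStrip_prodMap_id.1 h x)

lemma nil_mem_brokenWords_prodMap_id (hf : Function.Surjective fun x => (f x).head)
    (hid : f ≠ id) : [] ∈ brokenWords (Prod.map f id) := by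
  rintro ⟨v, hv⟩
  rw [mapsStrip_prodMap_id] at hv
  obtain rfl := eq_nil_of_forall_eq_append hf hv
  exact hid (funext hv)

lemma cons_mem_brokenWords_onTail {b : Bool} {u : List Bool} :
    b :: u ∈ brokenWords (Prod.map (onTail f) id) ↔ u ∈ brokenWords (Prod.map f id) := by
  refine not_congr ⟨fun ⟨v, hv⟩ => ?_, fun ⟨v, hv⟩ => ⟨b :: v, hv.onTail_cons b⟩⟩
  rw [mapsStrip_prodMap_id] at hv
  rcases v with _ | ⟨c, v⟩
  · have hhead := congrArg Stream'.head (hv (Stream'.const !b))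
    exact absurd (show b = !b from hhead) (by simp)
  · exact ⟨v, mapsStrip_prodMap_id.2 fun x => congrArg Stream'.tail (hv x)⟩

lemma brokenWords_onTail (hf : f ≠ id) :
    brokenWords (Prod.map (onTail f) id) =
      insert [] (List.cons false '' brokenWords (Prod.map f id) ∪
        List.cons true '' brokenWords (Prod.map f id)) := by
  ext u
  rcases u with _ | ⟨_ | _, u⟩
  · simpa using nil_mem_brokenWords_prodMap_id (f := onTail f) head_surjective (onTail_ne_id hf)
  · simpa using cons_mem_brokenWords_onTail
  · simpa using cons_mem_brokenWords_onTail

lemma encard_brokenWords_onTail (hf : f ≠ id) :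
    (brokenWords (Prod.map (onTail f) id)).encard =
      2 * (brokenWords (Prod.map f id)).encard + 1 := by
  have hdisj : Disjoint (List.cons false '' brokenWords (Prod.map f id))
      (List.cons true '' brokenWords (Prod.map f id)) := by
    simp [Set.disjoint_left]
  rw [brokenWords_onTail hf, Set.encard_insert_of_notMem (by simp), Set.encard_union_eq hdisj,
    List.cons_injective.encard_image, List.cons_injective.encard_image, two_mul]

lemma lexLT_cons (a b : Bool) (s t : Stream' Bool) :
    LexLT (Stream'.cons a s) (Stream'.cons b t) ↔
      (a = false ∧ b = true) ∨ (a = b ∧ LexLT s t) := by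
  constructor
  · rintro ⟨_ | n, hn, h0, h1⟩
    · exact Or.inl ⟨h0, h1⟩
    · exact Or.inr ⟨hn 0 n.succ_pos, n, fun k hk => hn (k + 1) (by omega), h0, h1⟩
  · rintro (⟨rfl, rfl⟩ | ⟨rfl, n, hn, h0, h1⟩)
    · exact ⟨0, by simp, rfl, rfl⟩
    · refine ⟨n + 1, fun k hk => ?_, h0, h1⟩
      cases k with
      | zero => rfl
      | succ k => exact hn k (by omega)

lemma lexLT_onTail (hf : ∀ s t, LexLT (f s) (f t) ↔ LexLT s t) (s t : Stream' Bool) :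
    LexLT (onTail f s) (onTail f t) ↔ LexLT s t := by
  rw [onTail, onTail, lexLT_cons, hf, ← lexLT_cons, Stream'.eta, Stream'.eta]

end OnTail

/-! ### The generator `X₀` -/

lemma x0Fun_ne_id : x0Fun ≠ id := fun h =>
  Bool.false_ne_true
    (congrArg Stream'.head (congrFun h (Stream'.cons true (Stream'.const false))))

lemma lexLT_x0Fun (s t : Stream' Bool) : LexLT (x0Fun s) (x0Fun t) ↔ LexLT s t := by
  have exists_cons_cons (s : Stream' Bool) : ∃ a b r, s = Stream'.cons a (Stream'.cons b r) :=
    ⟨s.head, s.tail.head, s.tail.tail, by rw [Stream'.eta, Stream'.eta]⟩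
  obtain ⟨a, b, s, rfl⟩ := exists_cons_cons s
  obtain ⟨c, d, t, rfl⟩ := exists_cons_cons t
  cases a <;> cases b <;> cases c <;> cases d <;> simp [x0Fun, lexLT_cons]

lemma isTreePairF_genX0 :
    IsTreePairF (.node () .nil (.node () .nil .nil)) (.node () (.node () .nil .nil) .nil)
      genX0 := by
  refine ⟨rfl, fun p hp z => ?_⟩
  simp only [treeLeaves, List.map_cons, List.map_nil, List.cons_append, List.nil_append,
    List.zip_cons_cons, List.zip_nil_left, List.mem_cons, List.not_mem_nil, or_false] at hp
  rcases hp with rfl | rfl | rfl <;> rfl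

lemma brokenWords_x0Fun : brokenWords (Prod.map x0Fun id) = {[], [true]} := by
  refine Set.Subset.antisymm ?_ (Set.pair_subset ?_ ?_)
  · have hsubset : brokenWords (Prod.map x0Fun id) ⊆ _ := isTreePairF_genX0.brokenWords_subset
    simpa [treeCarets, Set.subset_def] using hsubset
  · exact nil_mem_brokenWords_prodMap_id (fun b => ⟨Stream'.const b, by cases b <;> rfl⟩)
      x0Fun_ne_id
  · have hne : x0Fun ∘ Stream'.cons true ≠ id := fun h =>
      Bool.false_ne_true
        (congrArg (Stream'.get · 1) (congrFun h (Stream'.const false))).symm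
    have hnil := nil_mem_brokenWords_prodMap_id (f := x0Fun ∘ Stream'.cons true)
      (fun b => ⟨Stream'.const b, by cases b <;> rfl⟩) hne
    exact fun ⟨v, hv⟩ => hnil ⟨v, hv⟩

/-! ### The elements `w_n` -/

lemma witness_succ (n : ℕ) : witness (n + 1) = genC0⁻¹ * witness n * genC0 := by
  simp only [witness, pow_succ, mul_inv_rev, mul_assoc]

lemma coe_witness (n : ℕ) : ⇑(witness n).1 = Prod.map (onTail^[n] x0Fun) id := by
  induction n with
  | zero => rfl
  | succ n ih =>
    rw [witness_succ, Function.iterate_succ_apply']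
    change c0Perm.symm ∘ (witness n).1 ∘ c0Perm = _
    rw [ih]
    rfl

lemma encard_brokenWords_witness (n : ℕ) :
    (brokenWords (witness n).1).encard = (3 * 2 ^ n - 1 : ℕ) := by
  rw [coe_witness]
  induction n with
  | zero => exact (congrArg Set.encard brokenWords_x0Fun).trans (Set.encard_pair (by simp))
  | succ n ih =>
    have hne : onTail^[n] x0Fun ≠ id :=
      Function.Iterate.rec (· ≠ id) x0Fun_ne_id (fun _ => onTail_ne_id) n
    have hpos : 0 < 2 ^ n := by positivity
    rw [Function.iterate_succ_apply', encard_brokenWords_onTail hne, ih]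
    norm_cast
    omega

lemma witness_mem_verticalF (n : ℕ) : witness n ∈ verticalF := by
  constructor
  · rw [mem_verticalV_iff_finite_brokenWords, ← Set.encard_ne_top_iff, encard_brokenWords_witness]
    exact ENat.natCast_ne_top _
  · rw [coe_witness]
    exact fun p q => Function.Iterate.rec
      (fun f : Stream' Bool → Stream' Bool => ∀ s t, LexLT (f s) (f t) ↔ LexLT s t)
      lexLT_x0Fun (fun _ => lexLT_onTail) n p.1 q.1

lemma IsTreePairF.witness_succ {D R : BinaryTree Unit} {n : ℕ}
    (h : IsTreePairF D R (witness n)) :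
    IsTreePairF (.node () D D) (.node () R R) (witness (n + 1)) := by
  obtain ⟨hnodes, hstrips⟩ := h
  refine ⟨by simp only [BinaryTree.numNodes, hnodes], fun p hp => ?_⟩
  have hcons (b : Bool) : ∀ q ∈ (treeLeaves D).zip (treeLeaves R),
      MapsStrip (witness (n + 1)).1 (b :: q.1) (b :: q.2) := fun q hq => by
    have hq_strip : MapsStrip (witness n).1 q.1 q.2 := hstrips q hq
    rw [coe_witness] at hq_strip ⊢
    rw [Function.iterate_succ_apply']
    exact hq_strip.onTail_cons b
  rw [treeLeaves, treeLeaves, List.zip_append (by simp [length_treeLeaves, hnodes]), List.zip_map,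
    List.zip_map, List.mem_append, List.mem_map, List.mem_map] at hp
  rcases hp with ⟨q, hq, rfl⟩ | ⟨q, hq, rfl⟩
  exacts [hcons false q hq, hcons true q hq]

lemma exists_isTreePairF_witness (n : ℕ) :
    ∃ D R, IsTreePairF D R (witness n) ∧ D.numNodes = 3 * 2 ^ n - 1 := by
  induction n with
  | zero => exact ⟨_, _, isTreePairF_genX0, rfl⟩
  | succ n ih =>
    obtain ⟨D, R, h, hD⟩ := ih
    refine ⟨_, _, h.witness_succ, ?_⟩
    have hpos : 0 < 2 ^ n := by positivity
    simp only [BinaryTree.numNodes, hD]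
    omega

lemma caretNumberF_witness (n : ℕ) : caretNumberF (witness n) = (3 * 2 ^ n - 1 : ℕ) := by
  refine le_antisymm ?_ ?_
  · obtain ⟨D, R, h, hD⟩ := exists_isTreePairF_witness n
    exact hD ▸ iInf_le_of_le D (iInf₂_le R h)
  · exact encard_brokenWords_witness n ▸ encard_brokenWords_le_caretNumberF (witness n)

lemma exists_mul_two_pow_le_wordLength_witness {A : Set twoV} (hA : A.Finite)
    (hAV : A ⊆ verticalV) :
    ∃ c : ℝ, 0 < c ∧ ∀ n : ℕ,
      ENNReal.ofReal (c * 2 ^ n) ≤ ((wordLength A (witness n) : ℕ∞) : ℝ≥0∞) := by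
  obtain ⟨C, hC, hle⟩ := exists_encard_brokenWords_le_wordLength_mul hA hAV
  have hC_pos : (0 : ℝ) < C := by positivity
  refine ⟨(C : ℝ)⁻¹, by positivity, fun n => ?_⟩
  have hpow : ((2 ^ n : ℕ) : ℕ∞) ≤ wordLength A (witness n) * C :=
    calc ((2 ^ n : ℕ) : ℕ∞) ≤ (3 * 2 ^ n - 1 : ℕ) := by
          have hpos : 0 < 2 ^ n := by positivity
          exact_mod_cast (by omega : 2 ^ n ≤ 3 * 2 ^ n - 1)
      _ = (brokenWords (witness n).1).encard := (encard_brokenWords_witness n).symm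
      _ ≤ wordLength A (witness n) * C := hle _
  calc ENNReal.ofReal ((C : ℝ)⁻¹ * 2 ^ n) = ((2 ^ n : ℕ) : ℝ≥0∞) / C := by
        rw [inv_mul_eq_div, ENNReal.ofReal_div_of_pos hC_pos, ENNReal.ofReal_natCast]
        norm_cast
    _ ≤ ((wordLength A (witness n) : ℕ∞) : ℝ≥0∞) :=
        ENNReal.div_le_of_le_mul (by exact_mod_cast ENat.toENNReal_le.2 hpow)

lemma exists_eventually_pow_le_distortion_twoV {H : Subgroup twoV} {S A : Set twoV}
    (hH : verticalF ≤ H) (hC : genC0 ∈ Subgroup.closure S) (hX : genX0 ∈ Subgroup.closure S)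
    (hA : A.Finite) (hAV : A ⊆ verticalV) :
    ∃ a : ℝ, 1 < a ∧ ∀ᶠ n : ℕ in atTop,
      ENNReal.ofReal (a ^ n) ≤ ((distortion H S A n : ℕ∞) : ℝ≥0∞) := by
  obtain ⟨p, hp⟩ := ENat.ne_top_iff_exists.1 (wordLength_ne_top hC)
  obtain ⟨q, hq⟩ := ENat.ne_top_iff_exists.1 (wordLength_ne_top hX)
  obtain ⟨c, hc, hlower⟩ := exists_mul_two_pow_le_wordLength_witness hA hAV
  have hupper (n : ℕ) : wordLength S (witness n) ≤ (2 * p * n + q : ℕ) := by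
    refine (wordLength_conj_pow_le genC0 genX0 n).trans_eq ?_
    rw [← hp, ← hq]
    push_cast
    ring
  exact exists_eventually_pow_le_distortion (fun n => hH (witness_mem_verticalF n)) hupper
    one_lt_two hc hlower

lemma wordLength_witness_le {S : Set twoV} (hC : genC0 ∈ S) (hX : genX0 ∈ S) (n : ℕ) :
    wordLength S (witness n) ≤ (2 * n + 1 : ℕ) :=
  calc wordLength S (witness n)
      ≤ 2 * n * wordLength S genC0 + wordLength S genX0 := wordLength_conj_pow_le _ _ n
    _ ≤ 2 * n * 1 + 1 := by gcongr <;> exact wordLength_le_one ‹_›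
    _ = (2 * n + 1 : ℕ) := by push_cast; ring

lemma verticalF_le_verticalT : verticalF ≤ verticalT :=
  fun _ ⟨hg, h⟩ => ⟨hg, fun p q r => by simp only [CyclicLT, h]⟩

lemma verticalT_le_verticalV : verticalT ≤ verticalV := fun _ hg => hg.1

theorem theorem5p1_general :
    (∀ (H : Subgroup twoV) (S A : Set twoV), verticalF ≤ H →
      genC0 ∈ Subgroup.closure S → genX0 ∈ Subgroup.closure S → A.Finite → A ⊆ verticalV →
        ∃ a : ℝ, 1 < a ∧ ∀ᶠ n : ℕ in atTop,
          ENNReal.ofReal (a ^ n) ≤ ((distortion H S A n : ℕ∞) : ℝ≥0∞)) ∧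
    (∀ n : ℕ,
      (∀ S : Set twoV, genC0 ∈ S → genX0 ∈ S →
        wordLength S (witness n) ≤ ((2 * n + 1 : ℕ) : ℕ∞)) ∧
      witness n ∈ verticalF ∧ caretNumberF (witness n) = ((3 * 2 ^ n - 1 : ℕ) : ℕ∞)) ∧
    (∀ A : Set twoV, A.Finite → A ⊆ verticalV →
      ∃ c : ℝ, 0 < c ∧ ∀ n : ℕ,
        ENNReal.ofReal (c * 2 ^ n) ≤ ((wordLength A (witness n) : ℕ∞) : ℝ≥0∞)) :=
  ⟨fun _ _ _ => exists_eventually_pow_le_distortion_twoV,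
    fun n => ⟨fun _ hC hX => wordLength_witness_le hC hX n, witness_mem_verticalF n,
      caretNumberF_witness n⟩,
    fun _ => exists_mul_two_pow_le_wordLength_witness⟩

theorem theorem5p1 :
    (IsAtLeastExponentiallyDistorted verticalF ∧
      IsAtLeastExponentiallyDistorted verticalT ∧
      IsAtLeastExponentiallyDistorted verticalV) ∧
    (∀ n : ℕ,
      (∀ S : Set twoV, genC0 ∈ S → genX0 ∈ S →
        wordLength S (witness n) ≤ ((2 * n + 1 : ℕ) : ℕ∞)) ∧
      witness n ∈ verticalF ∧
      ((2 ^ n : ℕ) : ℕ∞) ≤ caretNumberF (witness n) ∧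
      caretNumberF (witness n) ≤ ((3 * 2 ^ n : ℕ) : ℕ∞)) ∧
    (∀ A : Set twoV, A.Finite → A ⊆ verticalV →
      ∃ c : ℝ, 0 < c ∧ ∀ n : ℕ,
        ENNReal.ofReal (c * 2 ^ n) ≤ ((wordLength A (witness n) : ℕ∞) : ℝ≥0∞)) := by
  obtain ⟨hdist, hwitness, hlength⟩ := theorem5p1_general
  have hdistorted {H : Subgroup twoV} (hF : verticalF ≤ H) (hV : H ≤ verticalV) :
      IsAtLeastExponentiallyDistorted H := fun S A _ hA hS hAH =>
    hdist H S A hF (by simp [hS]) (by simp [hS]) hA ((Subgroup.closure_le _).1 (hAH.trans_le hV))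
  have hcarets (n : ℕ) : 2 ^ n ≤ 3 * 2 ^ n - 1 := by have := n.two_pow_pos; omega
  refine ⟨⟨hdistorted le_rfl (verticalF_le_verticalT.trans verticalT_le_verticalV),
    hdistorted verticalF_le_verticalT verticalT_le_verticalV,
    hdistorted (verticalF_le_verticalT.trans verticalT_le_verticalV) le_rfl⟩, fun n => ?_, hlength⟩
  obtain ⟨hword, hmem, hcaret⟩ := hwitness n
  rw [hcaret]
  exact ⟨hword, hmem, by exact_mod_cast hcarets n, by exact_mod_cast Nat.sub_le _ 1⟩
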